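/- Let $\tau$ be a finite relational signature; all $\tau$-structures have non-empty domains. For a second-order $\tau$-sentence $\Phi$ let $\llbracket\Phi\rrbracket$ be the class of all finite models of $\Phi$. A second-order formula is an MSO formula if all its second-order variables are unary. It is a GSO formula (guarded second-order formula) if it is built from atomic formulas by $\wedge,\vee,\neg$, by (unrestricted) second-order quantification, and by guarded first-order quantification $\exists\bar y(\alpha\wedge\psi)$ and $\forall\bar y(\alpha\Rightarrow\psi)$, where $\alpha$ is an atomic $\tau$-formula (possibly an equality, but not an atom built with a second-order variable) that contains all free first-order variables of $\psi$. A class of finite $\tau$-structures is closed under homomorphisms if, whenever it contains $\mathfrak A$ and there is a homomorphism from $\mathfrak A$ to a finite $\tau$-structure $\mathfrak B$, it contains $\mathfrak B$; complements are taken within the class of all finite $\tau$-structures. A class of finite $\tau$-structures is a CSP if, for some (possibly infinite) $\tau$-structure $\mathfrak B$, it is the class of all finite $\tau$-structures that map homomorphically to $\mathfrak B$ (for non-empty classes this means: closed under disjoint unions and under inverse homomorphisms). **Lemma.** Let $\Phi$ be a GSO $\tau$-sentence such that the complement of $\llbracket\Phi\rrbracket$ is closed under homomorphisms. Then there are $m\ge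 0$ and GSO $\tau$-sentences $\Phi_1,\dots,\Phi_m$ such that each $\llbracket\Phi_i\rrbracket$ is a CSP and $\Phi$ and $\Phi_1\vee\dots\vee\Phi_m$ have the same finite models (the empty disjunction, $m=0$, being false); if $\llbracket\Phi\rrbracket\neq\emptyset$, then, with the same $\Phi_i$, $\Phi$ is equivalent to $\Phi_1\vee\dots\vee\Phi_m$ on all $\tau$-structures, finite or infinite. The same statement holds with MSO in place of GSO throughout. -/

import Mathlib

open FirstOrder

universe u v w

/-- Second-order formulas over a relational signature `L`. First-order variables are named by
natural numbers; a second-order (relation) variable is named by its arity `n` together with a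
natural number. Since `L` is relational, variables are the only terms. -/
inductive SOFormula (L : FirstOrder.Language.{u, v}) : Type v
  /-- the atom `x = y` -/
  | eq (x y : ℕ) : SOFormula L
  /-- the atom `R(x₁,…,xₙ)` for a symbol `R` of the signature -/
  | rel {n : ℕ} (R : L.Relations n) (x : Fin n → ℕ) : SOFormula L
  /-- the atom `X(x₁,…,xₙ)` for the `n`-ary second-order variable `X` -/
  | var (n X : ℕ) (x : Fin n → ℕ) : SOFormula L
  | neg (φ : SOFormula L) : SOFormula L
  | and (φ ψ : SOFormula L) : SOFormula L
  | or (φ ψ : SOFormula L) : SOFormula L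
  /-- first-order quantifiers -/
  | ex (x : ℕ) (φ : SOFormula L) : SOFormula L
  | all (x : ℕ) (φ : SOFormula L) : SOFormula L
  /-- quantifiers over the `n`-ary second-order variable `X` -/
  | exRel (n X : ℕ) (φ : SOFormula L) : SOFormula L
  | allRel (n X : ℕ) (φ : SOFormula L) : SOFormula L

namespace SOFormula

variable {L : FirstOrder.Language.{u, v}}

/-- `φ ⇒ ψ` -/
def imp (φ ψ : SOFormula L) : SOFormula L := or (neg φ) ψ

/-- `∃ y₁ … ∃ yₖ, φ` -/
def exs (ys : List ℕ) (φ : SOFormula L) : SOFormula L := ys.foldr ex φ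

/-- `∀ y₁ … ∀ yₖ, φ` -/
def alls (ys : List ℕ) (φ : SOFormula L) : SOFormula L := ys.foldr all φ

/-- The free first-order variables. -/
def freeVars : SOFormula L → Finset ℕ
  | eq x y => {x, y}
  | rel _ x => Finset.univ.image x
  | var _ _ x => Finset.univ.image x
  | neg φ => φ.freeVars
  | and φ ψ => φ.freeVars ∪ ψ.freeVars
  | or φ ψ => φ.freeVars ∪ ψ.freeVars
  | ex x φ => φ.freeVars \ {x}
  | all x φ => φ.freeVars \ {x}
  | exRel _ _ φ => φ.freeVars
  | allRel _ _ φ => φ.freeVars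

/-- The free second-order variables, as pairs (arity, name). -/
def freeRelVars : SOFormula L → Finset (ℕ × ℕ)
  | eq _ _ => ∅
  | rel _ _ => ∅
  | var n X _ => {(n, X)}
  | neg φ => φ.freeRelVars
  | and φ ψ => φ.freeRelVars ∪ ψ.freeRelVars
  | or φ ψ => φ.freeRelVars ∪ ψ.freeRelVars
  | ex _ φ => φ.freeRelVars
  | all _ φ => φ.freeRelVars
  | exRel n X φ => φ.freeRelVars \ {(n, X)}
  | allRel n X φ => φ.freeRelVars \ {(n, X)}

/-- A sentence has no free variables, of first or of second order. -/
def IsSentence (φ : SOFormula L) : Prop := φ.freeVars = ∅ ∧ φ.freeRelVars = ∅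

/-- Tarskian satisfaction (with unrestricted second-order quantification) under an assignment `v`
of elements to the first-order variables and `V` of relations to the second-order variables. -/
def Sat {A : Type w} [L.Structure A] :
    SOFormula L → (ℕ → A) → ((n : ℕ) → ℕ → (Fin n → A) → Prop) → Prop
  | eq x y, v, _ => v x = v y
  | rel R x, v, _ => FirstOrder.Language.Structure.RelMap R (fun i => v (x i))
  | var n X x, v, V => V n X (fun i => v (x i))
  | neg φ, v, V => ¬ φ.Sat v V
  | and φ ψ, v, V => φ.Sat v V ∧ ψ.Sat v V
  | or φ ψ, v, V => φ.Sat v V ∨ ψ.Sat v V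
  | ex x φ, v, V => ∃ a : A, φ.Sat (Function.update v x a) V
  | all x φ, v, V => ∀ a : A, φ.Sat (Function.update v x a) V
  | exRel n X φ, v, V =>
      ∃ R : (Fin n → A) → Prop, φ.Sat v (Function.update V n (Function.update (V n) X R))
  | allRel n X φ, v, V =>
      ∀ R : (Fin n → A) → Prop, φ.Sat v (Function.update V n (Function.update (V n) X R))

/-- `A ⊨ φ`. For a sentence `φ` and nonempty `A` the assignment is irrelevant. -/
def Models (A : Type w) [L.Structure A] (φ : SOFormula L) : Prop :=
  ∀ (v : ℕ → A) (V : (n : ℕ) → ℕ → (Fin n → A) → Prop), φ.Sat v V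

/-- The atomic formulas over the signature `L` (that is, without second-order variables). -/
inductive IsAtom : SOFormula L → Prop
  | eq (x y : ℕ) : IsAtom (eq x y)
  | rel {n : ℕ} (R : L.Relations n) (x : Fin n → ℕ) : IsAtom (rel R x)

/-- The formulas of guarded second-order logic: first-order quantification is guarded by an atom
over the signature `L`, second-order quantification is unrestricted. -/
inductive IsGuarded : SOFormula L → Prop
  | eq (x y : ℕ) : IsGuarded (eq x y)
  | rel {n : ℕ} (R : L.Relations n) (x : Fin n → ℕ) : IsGuarded (rel R x)
  | var (n X : ℕ) (x : Fin n → ℕ) : IsGuarded (var n X x)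
  | neg {φ : SOFormula L} : IsGuarded φ → IsGuarded (neg φ)
  | and {φ ψ : SOFormula L} : IsGuarded φ → IsGuarded ψ → IsGuarded (and φ ψ)
  | or {φ ψ : SOFormula L} : IsGuarded φ → IsGuarded ψ → IsGuarded (or φ ψ)
  | exs (ys : List ℕ) {α ψ : SOFormula L} : IsAtom α → IsGuarded ψ →
      ψ.freeVars ⊆ α.freeVars → IsGuarded (exs ys (SOFormula.and α ψ))
  | alls (ys : List ℕ) {α ψ : SOFormula L} : IsAtom α → IsGuarded ψ →
      ψ.freeVars ⊆ α.freeVars → IsGuarded (alls ys (imp α ψ))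
  | exRel (n X : ℕ) {φ : SOFormula L} : IsGuarded φ → IsGuarded (exRel n X φ)
  | allRel (n X : ℕ) {φ : SOFormula L} : IsGuarded φ → IsGuarded (allRel n X φ)

/-- The formulas of monadic second-order logic: every second-order variable is unary. -/
def IsMonadic : SOFormula L → Prop
  | eq _ _ => True
  | rel _ _ => True
  | var n _ _ => n = 1
  | neg φ => φ.IsMonadic
  | and φ ψ => φ.IsMonadic ∧ ψ.IsMonadic
  | or φ ψ => φ.IsMonadic ∧ ψ.IsMonadic
  | ex _ φ => φ.IsMonadic
  | all _ φ => φ.IsMonadic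
  | exRel n _ φ => n = 1 ∧ φ.IsMonadic
  | allRel n _ φ => n = 1 ∧ φ.IsMonadic

end SOFormula

/-- GSO sentences. -/
def IsGSOSentence {L : FirstOrder.Language.{u, v}} (φ : SOFormula L) : Prop := φ.IsSentence ∧ φ.IsGuarded

/-- MSO sentences. -/
def IsMSOSentence {L : FirstOrder.Language.{u, v}} (φ : SOFormula L) : Prop := φ.IsSentence ∧ φ.IsMonadic

/-- Finite `L`-structures; the domain is nonempty. -/
structure FinStr (L : FirstOrder.Language.{u, v}) where
  carrier : Type w
  [str : L.Structure carrier]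
  [finite : Finite carrier]
  [nonempty : Nonempty carrier]

namespace FinStr

variable {L : FirstOrder.Language.{u, v}}

instance : CoeSort (FinStr.{u, v, w} L) (Type w) := ⟨FinStr.carrier⟩

instance (A : FinStr.{u, v, w} L) : L.Structure A := A.str

instance (A : FinStr.{u, v, w} L) : Finite A := A.finite

instance (A : FinStr.{u, v, w} L) : Nonempty A := A.nonempty

end FinStr

/-- `⟦φ⟧`: the class of all finite models of `φ`. -/
def finModels {L : FirstOrder.Language.{u, v}} (φ : SOFormula L) : Set (FinStr.{u, v, w} L) :=
  {A | SOFormula.Models A φ}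

/-- A class of finite structures is closed under homomorphisms if it contains the target of every
homomorphism between finite structures whose source it contains. -/
def ClosedUnderHom {L : FirstOrder.Language.{u, v}} (C : Set (FinStr.{u, v, w} L)) : Prop :=
  ∀ A B : FinStr.{u, v, w} L, A ∈ C → Nonempty (A →[L] B) → B ∈ C

/-- `CSP(B)`: the class of all finite structures that map homomorphically to `B`. -/
def csp (L : FirstOrder.Language.{u, v}) (B : Type w) [L.Structure B] : Set (FinStr.{u, v, w} L) :=
  {A | Nonempty (A →[L] B)}

/-- A class of finite structures is a CSP if it is `CSP(B)` for some structure `B` (with nonempty,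
possibly infinite, domain). -/
def IsCSP {L : FirstOrder.Language.{u, v}} (C : Set (FinStr.{u, v, w} L)) : Prop :=
  ∃ (B : Type w) (_ : L.Structure B), Nonempty B ∧ C = csp L B

/-- `Φ` decomposes into finitely many sentences from the logic `S`, each of which describes a CSP:
`Φ` and the disjunction of these sentences hold in the same finite structures and, provided that
`Φ` has a finite model at all, even in the same structures, finite or infinite. (The proviso is
needed: a CSP is never the empty class, so if `Φ` has infinite models only, then the disjunction
must be the empty one, which is false everywhere.) -/
def DecomposesIntoCSPs {L : FirstOrder.Language.{u, v}} (S : SOFormula L → Prop) (Φ : SOFormula L) : Prop :=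
  ∃ (m : ℕ) (Ψ : Fin m → SOFormula L),
    (∀ i, S (Ψ i) ∧ IsCSP (finModels.{u, v, w} (Ψ i))) ∧
    finModels.{u, v, w} Φ = ⋃ i, finModels.{u, v, w} (Ψ i) ∧
    ((finModels.{u, v, w} Φ).Nonempty →
      ∀ (A : Type w) [L.Structure A] [Nonempty A],
        SOFormula.Models A Φ ↔ ∃ i, SOFormula.Models A (Ψ i))

/-! Let C be the class of finite models of Φ, which is closed under inverse homomorphisms, and let
U(D) = {A | A ⊕ D ∈ C}. Two facts carry the proof.

Feferman–Vaught (`IsGuarded.splits`, `IsMonadic.splits`): there are finitely many pairs (α, β) of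
sentences of the same logic such that A ⊕ D ⊨ Φ iff A ⊨ α and D ⊨ β for some pair. So U(D) is
defined by the disjunction of those α whose β holds in D, and only finitely many classes U(D) occur.

Order (`exists_ideal_cover`): U is antitone in the homomorphism order. Call D ∈ C stable if U(E) =
U(D) for every E ∈ C above D. If D is stable and A, B ∈ U(D), then A ⊕ D ∈ C lies above D, so B ∈
U(A ⊕ D) and hence A ⊕ B ∈ U(D); thus U(D) is a CSP (`isCSP_of_closed`). As there are finitely many
U(D), every A ∈ C has a stable E above it, and A ⊕ E → E gives A ∈ U(E) ⊆ C. So C is a finite union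
of definable CSPs; `decomposesIntoCSPs_of_splits` then corrects the sentences on infinite
structures. -/

namespace SOFormula

variable {L : FirstOrder.Language.{u, v}}

/-! ### Semantics: dependence on free variables, quantifier blocks, Boolean combinations -/

theorem sat_congr {A : Type w} [L.Structure A] (φ : SOFormula L) :
    ∀ {v v' : ℕ → A} {V V' : (n : ℕ) → ℕ → (Fin n → A) → Prop},
      (∀ x ∈ φ.freeVars, v x = v' x) → (∀ n X, (n, X) ∈ φ.freeRelVars → V n X = V' n X) →
      (φ.Sat v V ↔ φ.Sat v' V') := by
  have upd : ∀ (v v' : ℕ → A) (x : ℕ) (a : A) (s : Finset ℕ), (∀ y ∈ s \ {x}, v y = v' y) →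
      ∀ y ∈ s, Function.update v x a y = Function.update v' x a y := by
    intro v v' x a s h y hy
    by_cases hyx : y = x
    · subst hyx; simp
    · simp [hyx, h y (by simp [hy, hyx])]
  have updRel : ∀ (V V' : (n : ℕ) → ℕ → (Fin n → A) → Prop) (n X : ℕ) (R : (Fin n → A) → Prop)
      (s : Finset (ℕ × ℕ)), (∀ m Y, (m, Y) ∈ s \ {(n, X)} → V m Y = V' m Y) →
      ∀ m Y, (m, Y) ∈ s → Function.update V n (Function.update (V n) X R) m Y =
        Function.update V' n (Function.update (V' n) X R) m Y := by
    intro V V' n X R s h m Y hY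
    by_cases hm : m = n
    · subst hm
      by_cases hYX : Y = X
      · subst hYX; simp
      · simp [hYX, h m Y (by simp [hY, hYX])]
    · simp [hm, h m Y (by simp [hY, hm])]
  induction φ with
  | eq x y =>
    intro v v' V V' h _
    simp only [freeVars, Finset.mem_insert, Finset.mem_singleton, forall_eq_or_imp, forall_eq] at h
    simp [Sat, h.1, h.2]
  | rel R x =>
    intro v v' V V' h _
    have : (fun i => v (x i)) = fun i => v' (x i) := funext fun i => h _ (by simp [freeVars])
    simp [Sat, this]
  | var n X x =>
    intro v v' V V' h h'
    have : (fun i => v (x i)) = fun i => v' (x i) := funext fun i => h _ (by simp [freeVars])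
    simp [Sat, this, h' n X (by simp [freeRelVars])]
  | neg φ ih => exact fun h h' => not_congr (ih h h')
  | and φ ψ ih₁ ih₂ =>
    intro v v' V V' h h'
    exact and_congr (ih₁ (fun x hx => h x (Finset.mem_union_left _ hx))
        fun n X hX => h' n X (Finset.mem_union_left _ hX))
      (ih₂ (fun x hx => h x (Finset.mem_union_right _ hx))
        fun n X hX => h' n X (Finset.mem_union_right _ hX))
  | or φ ψ ih₁ ih₂ =>
    intro v v' V V' h h'
    exact or_congr (ih₁ (fun x hx => h x (Finset.mem_union_left _ hx))
        fun n X hX => h' n X (Finset.mem_union_left _ hX))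
      (ih₂ (fun x hx => h x (Finset.mem_union_right _ hx))
        fun n X hX => h' n X (Finset.mem_union_right _ hX))
  | ex x φ ih => exact fun h h' => exists_congr fun a => ih (upd _ _ x a _ h) h'
  | all x φ ih => exact fun h h' => forall_congr' fun a => ih (upd _ _ x a _ h) h'
  | exRel n X φ ih => exact fun h h' => exists_congr fun R => ih h (updRel _ _ n X R _ h')
  | allRel n X φ ih => exact fun h h' => forall_congr' fun R => ih h (updRel _ _ n X R _ h')

theorem IsSentence.models_iff {A : Type w} [L.Structure A] {φ : SOFormula L} (h : φ.IsSentence)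
    (v : ℕ → A) (V : (n : ℕ) → ℕ → (Fin n → A) → Prop) : Models A φ ↔ φ.Sat v V :=
  ⟨fun hA => hA v V, fun hs _ _ =>
    (sat_congr φ (by simp [h.1]) (by simp [h.2])).1 hs⟩

theorem freeVars_exs (ys : List ℕ) (φ : SOFormula L) :
    (exs ys φ).freeVars = φ.freeVars \ ys.toFinset := by
  induction ys with
  | nil => simp [exs]
  | cons y ys ih =>
    have : (exs (y :: ys) φ).freeVars = (exs ys φ).freeVars \ {y} := rfl
    rw [this, ih]; ext; simp; tauto

theorem freeVars_alls (ys : List ℕ) (φ : SOFormula L) :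
    (alls ys φ).freeVars = φ.freeVars \ ys.toFinset := by
  induction ys with
  | nil => simp [alls]
  | cons y ys ih =>
    have : (alls (y :: ys) φ).freeVars = (alls ys φ).freeVars \ {y} := rfl
    rw [this, ih]; ext; simp; tauto

theorem freeRelVars_exs (ys : List ℕ) (φ : SOFormula L) :
    (exs ys φ).freeRelVars = φ.freeRelVars := by
  induction ys with
  | nil => rfl
  | cons y ys ih => exact ih

theorem freeRelVars_alls (ys : List ℕ) (φ : SOFormula L) :
    (alls ys φ).freeRelVars = φ.freeRelVars := by
  induction ys with
  | nil => rfl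
  | cons y ys ih => exact ih

/-- A block of quantifiers is one change of assignment. Agreement is asked only on the free
variables of `φ`, which leaves `v'` at liberty to take convenient values elsewhere. -/
theorem sat_exs {A : Type w} [L.Structure A] (ys : List ℕ) (φ : SOFormula L) (v : ℕ → A)
    (V : (n : ℕ) → ℕ → (Fin n → A) → Prop) :
    (exs ys φ).Sat v V ↔
      ∃ v' : ℕ → A, (∀ x ∈ φ.freeVars, x ∉ ys → v' x = v x) ∧ φ.Sat v' V := by
  induction ys generalizing v with
  | nil =>
    refine ⟨fun h => ⟨v, by simp, h⟩, fun ⟨v', h, hs⟩ => ?_⟩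
    exact (sat_congr φ (fun x hx => h x hx (by simp)) (by simp)).1 hs
  | cons y ys ih =>
    change (∃ a, (exs ys φ).Sat (Function.update v y a) V) ↔ _
    simp only [ih]
    constructor
    · rintro ⟨a, v', h, hs⟩
      refine ⟨v', fun x hx hxy => ?_, hs⟩
      simp only [List.mem_cons, not_or] at hxy
      rw [h x hx hxy.2, Function.update_of_ne hxy.1]
    · rintro ⟨v', h, hs⟩
      refine ⟨v' y, v', fun x hx hxy => ?_, hs⟩
      by_cases hy : x = y
      · subst hy; simp
      · rw [Function.update_of_ne hy]; exact h x hx (by simp [hy, hxy])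

theorem sat_alls {A : Type w} [L.Structure A] (ys : List ℕ) (φ : SOFormula L) (v : ℕ → A)
    (V : (n : ℕ) → ℕ → (Fin n → A) → Prop) :
    (alls ys φ).Sat v V ↔ ¬ (exs ys (neg φ)).Sat v V := by
  induction ys generalizing v with
  | nil => simp [alls, exs, Sat]
  | cons y ys ih =>
    change (∀ a, (alls ys φ).Sat (Function.update v y a) V) ↔
      ¬ ∃ a, (exs ys (neg φ)).Sat (Function.update v y a) V
    simp [ih]

/-- A guarded, monadic sentence that holds in every nonempty structure. -/
def top : SOFormula L := exs [0] (and (eq 0 0) (eq 0 0))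

theorem sat_top {A : Type w} [L.Structure A] (v : ℕ → A)
    (V : (n : ℕ) → ℕ → (Fin n → A) → Prop) : (top : SOFormula L).Sat v V :=
  ⟨v 0, rfl, rfl⟩

theorem isSentence_top : (top : SOFormula L).IsSentence :=
  ⟨by simp [top, exs, freeVars], by simp [top, exs, freeRelVars]⟩

/-- The disjunction of a list of formulas. -/
def disj (l : List (SOFormula L)) : SOFormula L := l.foldr or (neg top)

theorem sat_disj {A : Type w} [L.Structure A] (l : List (SOFormula L)) (v : ℕ → A)
    (V : (n : ℕ) → ℕ → (Fin n → A) → Prop) : (disj l).Sat v V ↔ ∃ φ ∈ l, φ.Sat v V := by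
  induction l with
  | nil => simp [disj, Sat, sat_top]
  | cons φ l ih =>
    change φ.Sat v V ∨ (disj l).Sat v V ↔ _
    simp [ih]

theorem IsSentence.neg {φ : SOFormula L} (h : φ.IsSentence) : φ.neg.IsSentence := h

theorem IsSentence.and {φ ψ : SOFormula L} (h : φ.IsSentence) (h' : ψ.IsSentence) :
    (φ.and ψ).IsSentence := by
  simp [IsSentence, freeVars, freeRelVars, h.1, h.2, h'.1, h'.2]

theorem IsSentence.or {φ ψ : SOFormula L} (h : φ.IsSentence) (h' : ψ.IsSentence) :
    (φ.or ψ).IsSentence := h.and h'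

/-- A set of formulas that contains the true sentence and is closed under the connectives. -/
structure IsBooleanClosed (K : SOFormula L → Prop) : Prop where
  top : K top
  neg {φ : SOFormula L} : K φ → K (neg φ)
  and {φ ψ : SOFormula L} : K φ → K ψ → K (and φ ψ)
  or {φ ψ : SOFormula L} : K φ → K ψ → K (or φ ψ)

theorem isBooleanClosed_isGuarded : IsBooleanClosed (IsGuarded (L := L)) :=
  ⟨.exs _ (.eq _ _) (.eq _ _) (Finset.Subset.refl _), .neg, .and, .or⟩

theorem isBooleanClosed_isMonadic : IsBooleanClosed (IsMonadic (L := L)) :=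
  ⟨by simp [top, exs, IsMonadic], id, .intro, .intro⟩

theorem IsBooleanClosed.disj {K : SOFormula L → Prop} (hK : IsBooleanClosed K)
    {l : List (SOFormula L)} (h : ∀ φ ∈ l, K φ) : K (disj l) := by
  induction l with
  | nil => exact hK.neg hK.top
  | cons φ l ih =>
    exact hK.or (h φ (by simp)) (ih fun ψ hψ => h ψ (by simp [hψ]))

end SOFormula

/-! ### Disjoint unions and glued assignments -/

/-- The disjoint union of two relational structures. -/
instance sumStructure {L : FirstOrder.Language.{u, v}} [L.IsRelational] {A B : Type w}
    [L.Structure A] [L.Structure B] : L.Structure (A ⊕ B) where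
  funMap f := isEmptyElim f
  RelMap R x := (∃ a, x = Sum.inl ∘ a ∧ FirstOrder.Language.Structure.RelMap R a) ∨
    ∃ b, x = Sum.inr ∘ b ∧ FirstOrder.Language.Structure.RelMap R b

namespace SOFormula

variable {L : FirstOrder.Language.{u, v}}

/-- The preimage of an assignment to the second-order variables. -/
def pullback {A C : Type w} (f : A → C) (V : (n : ℕ) → ℕ → (Fin n → C) → Prop) :
    (n : ℕ) → ℕ → (Fin n → A) → Prop := fun n X a => V n X (f ∘ a)

theorem pullback_update {A C : Type w} (f : A → C) (V : (n : ℕ) → ℕ → (Fin n → C) → Prop)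
    (n X : ℕ) (R : (Fin n → C) → Prop) :
    pullback f (Function.update V n (Function.update (V n) X R)) =
      Function.update (pullback f V) n
        (Function.update (pullback f V n) X fun a => R (f ∘ a)) := by
  funext m Y a
  by_cases hm : m = n
  · subst hm
    by_cases hY : Y = X
    · subst hY; simp [pullback]
    · simp [pullback, hY]
  · simp [pullback, hm]

/-- The assignment into `A ⊕ B` that follows `vA` on the variables in `P` and `vB` elsewhere. -/
def glue {A B : Type w} (P : ℕ → Bool) (vA : ℕ → A) (vB : ℕ → B) (x : ℕ) : A ⊕ B :=
  bif P x then Sum.inl (vA x) else Sum.inr (vB x)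

theorem glue_true {A B : Type w} {P : ℕ → Bool} {vA : ℕ → A} {vB : ℕ → B} {x : ℕ}
    (h : P x = true) : glue P vA vB x = Sum.inl (vA x) := by simp [glue, h]

theorem glue_false {A B : Type w} {P : ℕ → Bool} {vA : ℕ → A} {vB : ℕ → B} {x : ℕ}
    (h : P x = false) : glue P vA vB x = Sum.inr (vB x) := by simp [glue, h]

theorem exists_eq_glue {A B : Type w} [Nonempty A] [Nonempty B] (v : ℕ → A ⊕ B) :
    ∃ (P : ℕ → Bool) (vA : ℕ → A) (vB : ℕ → B), v = glue P vA vB := by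
  -- The arbitrary elements are values that `glue` never reads.
  refine ⟨fun x => (v x).isLeft, fun x => (v x).elim id fun _ => Classical.arbitrary A,
    fun x => (v x).elim (fun _ => Classical.arbitrary B) id, funext fun x => ?_⟩
  cases h : v x <;> simp [glue, h]

theorem update_glue_inl {A B : Type w} (P : ℕ → Bool) (vA : ℕ → A) (vB : ℕ → B) (x : ℕ) (a : A) :
    Function.update (glue P vA vB) x (Sum.inl a) =
      glue (Function.update P x true) (Function.update vA x a) vB := by
  funext y
  by_cases h : y = x
  · subst h; simp [glue]
  · simp [glue, h]

theorem update_glue_inr {A B : Type w} (P : ℕ → Bool) (vA : ℕ → A) (vB : ℕ → B) (x : ℕ) (b : B) :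
    Function.update (glue P vA vB) x (Sum.inr b) =
      glue (Function.update P x false) vA (Function.update vB x b) := by
  funext y
  by_cases h : y = x
  · subst h; simp [glue]
  · simp [glue, h]

/-- Elements of different summands are distinct, and no related tuple mixes the summands. For a
nullary symbol both side conditions are vacuous, and the atom may hold on either side. -/
theorem IsAtom.sat_glue [L.IsRelational] {α : SOFormula L} (hα : α.IsAtom) {A B : Type w}
    [L.Structure A] [L.Structure B] (P : ℕ → Bool) (vA : ℕ → A) (vB : ℕ → B)
    (V : (n : ℕ) → ℕ → (Fin n → A ⊕ B) → Prop) :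
    α.Sat (glue P vA vB) V ↔
      ((∀ x ∈ α.freeVars, P x = true) ∧ α.Sat vA (pullback Sum.inl V)) ∨
      ((∀ x ∈ α.freeVars, P x = false) ∧ α.Sat vB (pullback Sum.inr V)) := by
  cases hα with
  | eq x y =>
    simp only [Sat, glue, freeVars, Finset.mem_insert, Finset.mem_singleton, forall_eq_or_imp,
      forall_eq]
    cases P x <;> cases P y <;> simp
  | rel R x =>
    simp only [Sat, freeVars, Finset.mem_image, Finset.mem_univ, true_and, forall_exists_index,
      forall_apply_eq_imp_iff]
    refine or_congr ⟨?_, ?_⟩ ⟨?_, ?_⟩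
    · rintro ⟨a, h, hR⟩
      have key : ∀ i, P (x i) = true ∧ vA (x i) = a i := by
        intro i
        have := congrFun h i
        cases hP : P (x i) <;> simp [glue, hP] at this ⊢
        exact this
      refine ⟨fun i => (key i).1, ?_⟩
      rwa [show (fun i => vA (x i)) = a from funext fun i => (key i).2]
    · rintro ⟨h, hR⟩
      exact ⟨_, funext fun i => glue_true (h i), hR⟩
    · rintro ⟨a, h, hR⟩
      have key : ∀ i, P (x i) = false ∧ vB (x i) = a i := by
        intro i
        have := congrFun h i
        cases hP : P (x i) <;> simp [glue, hP] at this ⊢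
        exact this
      refine ⟨fun i => (key i).1, ?_⟩
      rwa [show (fun i => vB (x i)) = a from funext fun i => (key i).2]
    · rintro ⟨h, hR⟩
      exact ⟨_, funext fun i => glue_false (h i), hR⟩

/-! ### Feferman–Vaught decomposition over disjoint unions -/

/-- `α` belongs to `K` and its free variables are free variables of `φ`, those of first order
from the side `b` of `P`. -/
structure IsPart (K : SOFormula L → Prop) (P : ℕ → Bool) (b : Bool) (φ α : SOFormula L) : Prop where
  mem : K α
  freeVars : ∀ x ∈ α.freeVars, x ∈ φ.freeVars ∧ P x = b
  freeRelVars : α.freeRelVars ⊆ φ.freeRelVars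

theorem IsPart.top {K : SOFormula L → Prop} (hK : IsBooleanClosed K) {P : ℕ → Bool} {b : Bool}
    {φ : SOFormula L} : IsPart K P b φ top :=
  ⟨hK.top, by simp [isSentence_top.1], by simp [isSentence_top.2]⟩

theorem IsPart.neg {K : SOFormula L → Prop} (hK : IsBooleanClosed K) {P : ℕ → Bool} {b : Bool}
    {φ α : SOFormula L} (h : IsPart K P b φ α) : IsPart K P b φ (neg α) :=
  ⟨hK.neg h.mem, h.freeVars, h.freeRelVars⟩

theorem IsPart.and {K : SOFormula L → Prop} (hK : IsBooleanClosed K) {P : ℕ → Bool} {b : Bool}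
    {φ α β : SOFormula L} (h : IsPart K P b φ α) (h' : IsPart K P b φ β) :
    IsPart K P b φ (and α β) :=
  ⟨hK.and h.mem h'.mem, fun x hx => (Finset.mem_union.1 hx).elim (h.freeVars x) (h'.freeVars x),
    Finset.union_subset h.freeRelVars h'.freeRelVars⟩

theorem IsPart.mono {K : SOFormula L → Prop} {P : ℕ → Bool} {b : Bool}
    {φ ψ α : SOFormula L} (h : IsPart K P b φ α) (hv : φ.freeVars ⊆ ψ.freeVars)
    (hV : φ.freeRelVars ⊆ ψ.freeRelVars) : IsPart K P b ψ α :=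
  ⟨h.mem, fun x hx => ⟨hv (h.freeVars x hx).1, (h.freeVars x hx).2⟩, h.freeRelVars.trans hV⟩

theorem IsPart.exRel {K : SOFormula L → Prop} {P : ℕ → Bool} {b : Bool} {n X : ℕ}
    {φ α : SOFormula L} (h : IsPart K P b φ α)
    (hα : K (exRel n X α)) : IsPart K P b (exRel n X φ) (exRel n X α) :=
  ⟨hα, h.freeVars, Finset.sdiff_subset_sdiff h.freeRelVars subset_rfl⟩

/-- The formula that fixes the truth value of the nullary variable `X`. -/
def nullaryLit (X : ℕ) : Bool → SOFormula L
  | true => var 0 X Fin.elim0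
  | false => neg (var 0 X Fin.elim0)

theorem sat_nullaryLit {A : Type w} [L.Structure A] (X : ℕ) (b : Bool) (v : ℕ → A)
    (V : (n : ℕ) → ℕ → (Fin n → A) → Prop) :
    (nullaryLit (L := L) X b).Sat v V ↔ V 0 X = fun _ => (b = true) := by
  have key : (V 0 X = fun _ => (b = true)) ↔ (V 0 X Fin.elim0 ↔ b = true) := by
    refine ⟨fun h => by rw [h], fun h => funext fun a => ?_⟩
    rw [Subsingleton.elim a Fin.elim0, h]
  have hv : (fun i => v (Fin.elim0 i)) = (Fin.elim0 : Fin 0 → A) := Subsingleton.elim _ _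
  rw [key]
  cases b <;> simp [nullaryLit, Sat, hv]

/-- The negation is a conjunction of clauses ¬α ∨ ¬β; distributing, each entry of `l'` picks for
every pair of `l` the component to negate. -/
theorem exists_neg_list {K : SOFormula L → Prop} (hK : IsBooleanClosed K) {P : ℕ → Bool}
    {φ : SOFormula L} (l : List (SOFormula L × SOFormula L))
    (hl : ∀ p ∈ l, IsPart K P true φ p.1 ∧ IsPart K P false φ p.2) :
    ∃ l' : List (SOFormula L × SOFormula L),
      (∀ p ∈ l', IsPart K P true φ p.1 ∧ IsPart K P false φ p.2) ∧
      ∀ (A B : Type w) [L.Structure A] [L.Structure B] (vA : ℕ → A) (vB : ℕ → B)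
        (VA : (n : ℕ) → ℕ → (Fin n → A) → Prop) (VB : (n : ℕ) → ℕ → (Fin n → B) → Prop),
        (¬ ∃ p ∈ l, p.1.Sat vA VA ∧ p.2.Sat vB VB) ↔
          ∃ p ∈ l', p.1.Sat vA VA ∧ p.2.Sat vB VB := by
  induction l with
  | nil =>
    exact ⟨[(SOFormula.top, SOFormula.top)], by simpa using ⟨IsPart.top hK, IsPart.top hK⟩,
      by simp [sat_top]⟩
  | cons q l ih =>
    obtain ⟨l', h, hs⟩ := ih fun p hp => hl p (List.mem_cons_of_mem _ hp)
    have hq := hl q (by simp)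
    refine ⟨l'.map (fun p => (SOFormula.and (SOFormula.neg q.1) p.1, p.2)) ++
      l'.map (fun p => (p.1, SOFormula.and (SOFormula.neg q.2) p.2)), ?_, ?_⟩
    · intro r hr
      rcases List.mem_append.1 hr with hr | hr <;> obtain ⟨p, hp, rfl⟩ := List.mem_map.1 hr
      · exact ⟨(hq.1.neg hK).and hK (h p hp).1, (h p hp).2⟩
      · exact ⟨(h p hp).1, (hq.2.neg hK).and hK (h p hp).2⟩
    · intro A B _ _ vA vB VA VB
      rw [List.exists_mem_cons_iff, not_or, hs A B vA vB VA VB]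
      simp only [List.mem_append,
        or_and_right, exists_or, List.mem_map, ↓existsAndEq, and_true, Sat]
      constructor
      · rintro ⟨h1, p, hp, h2⟩
        by_cases hq1 : q.1.Sat vA VA
        · exact Or.inr ⟨p, hp, h2.1, fun hq2 => h1 ⟨hq1, hq2⟩, h2.2⟩
        · exact Or.inl ⟨p, hp, ⟨hq1, h2.1⟩, h2.2⟩
      · rintro (⟨p, hp, h1, h2⟩ | ⟨p, hp, h1, h2⟩)
        · exact ⟨fun h => h1.1 h.1, p, hp, h1.2, h2⟩
        · exact ⟨fun h => h2.1 h.2, p, hp, h1, h2.2⟩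

/-- The list `l` of pairs of formulas describes satisfaction of `φ` in disjoint unions `A ⊕ B`,
under assignments that map the variables in `P` to `A` and the others to `B`. -/
def SplitsBy [L.IsRelational] (P : ℕ → Bool) (φ : SOFormula L)
    (l : List (SOFormula L × SOFormula L)) : Prop :=
  ∀ (A B : Type w) [L.Structure A] [L.Structure B] (vA : ℕ → A) (vB : ℕ → B)
    (V : (n : ℕ) → ℕ → (Fin n → A ⊕ B) → Prop), φ.Sat (glue P vA vB) V ↔
      ∃ p ∈ l, p.1.Sat vA (pullback Sum.inl V) ∧ p.2.Sat vB (pullback Sum.inr V)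

/-- `φ` has a Feferman–Vaught decomposition over disjoint unions into formulas from `K`. -/
def Splits [L.IsRelational] (K : SOFormula L → Prop) (P : ℕ → Bool) (φ : SOFormula L) : Prop :=
  ∃ l : List (SOFormula L × SOFormula L),
    (∀ p ∈ l, IsPart K P true φ p.1 ∧ IsPart K P false φ p.2) ∧ SplitsBy.{u, v, w} P φ l

section Splits

variable [L.IsRelational] {K : SOFormula L → Prop} {P : ℕ → Bool} {φ ψ : SOFormula L}

theorem Splits.congr (h : Splits.{u, v, w} K P φ) (hv : φ.freeVars = ψ.freeVars)
    (hV : φ.freeRelVars = ψ.freeRelVars)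
    (hs : ∀ (A : Type w) [L.Structure A] (v : ℕ → A) (V : (n : ℕ) → ℕ → (Fin n → A) → Prop),
      φ.Sat v V ↔ ψ.Sat v V) : Splits.{u, v, w} K P ψ := by
  obtain ⟨l, hl, hl'⟩ := h
  exact ⟨l, fun p hp => ⟨(hl p hp).1.mono hv.subset hV.subset, (hl p hp).2.mono hv.subset hV.subset⟩,
    fun A B _ _ vA vB V => (hs _ _ _).symm.trans (hl' A B vA vB V)⟩

theorem Splits.or (h : Splits.{u, v, w} K P φ) (h' : Splits.{u, v, w} K P ψ) :
    Splits.{u, v, w} K P (or φ ψ) := by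
  obtain ⟨l, hl, hs⟩ := h
  obtain ⟨l', hl', hs'⟩ := h'
  refine ⟨l ++ l', fun p hp => ?_, fun A B _ _ vA vB V => ?_⟩
  · rcases List.mem_append.1 hp with hp | hp
    · exact ⟨(hl p hp).1.mono Finset.subset_union_left Finset.subset_union_left,
        (hl p hp).2.mono Finset.subset_union_left Finset.subset_union_left⟩
    · exact ⟨(hl' p hp).1.mono Finset.subset_union_right Finset.subset_union_right,
        (hl' p hp).2.mono Finset.subset_union_right Finset.subset_union_right⟩
  · simp only [Sat, hs A B vA vB V, hs' A B vA vB V, List.mem_append, or_and_right, exists_or]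

theorem Splits.neg (hK : IsBooleanClosed K) (h : Splits.{u, v, w} K P φ) :
    Splits.{u, v, w} K P (neg φ) := by
  obtain ⟨l, hl, hs⟩ := h
  obtain ⟨l', hl', hs'⟩ := exists_neg_list.{u, v, w} hK l hl
  exact ⟨l', fun p hp => ⟨(hl' p hp).1.mono subset_rfl subset_rfl,
    (hl' p hp).2.mono subset_rfl subset_rfl⟩,
    fun A B _ _ vA vB V => (not_congr (hs A B vA vB V)).trans (hs' A B vA vB _ _)⟩

theorem Splits.and (hK : IsBooleanClosed K) (h : Splits.{u, v, w} K P φ)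
    (h' : Splits.{u, v, w} K P ψ) : Splits.{u, v, w} K P (and φ ψ) :=
  (((h.neg hK).or (h'.neg hK)).neg hK).congr rfl rfl fun _ _ _ _ => by simp [Sat]

theorem splits_atom (hK : IsBooleanClosed K) {α : SOFormula L} (hα : α.IsAtom) (hKα : K α) :
    Splits.{u, v, w} K P α := by
  classical
  -- Both tests succeed only if `α` has no variables; if both fail, the list is empty, as a mixed
  -- atom is false.
  refine ⟨(if ∀ x ∈ α.freeVars, P x = true then [(α, SOFormula.top)] else []) ++
    (if ∀ x ∈ α.freeVars, P x = false then [(SOFormula.top, α)] else []), fun p hp => ?_,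
    fun A B _ _ vA vB V => ?_⟩
  · rcases List.mem_append.1 hp with hp | hp <;> split_ifs at hp with h
    · rw [List.mem_singleton.1 hp]
      exact ⟨⟨hKα, fun x hx => ⟨hx, h x hx⟩, subset_rfl⟩, IsPart.top hK⟩
    · simp at hp
    · rw [List.mem_singleton.1 hp]
      exact ⟨IsPart.top hK, ⟨hKα, fun x hx => ⟨hx, h x hx⟩, subset_rfl⟩⟩
    · simp at hp
  · rw [hα.sat_glue]
    simp only [List.mem_append, or_and_right, exists_or]
    refine or_congr ?_ ?_ <;> split_ifs with h
    · rw [and_iff_right h]; simp [sat_top]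
    · simp only [h, false_and, List.not_mem_nil, exists_false]
    · rw [and_iff_right h]; simp [sat_top]
    · simp only [h, false_and, List.not_mem_nil, exists_false]

/-- The arguments must lie on one side: a mixed tuple of a relation on `A ⊕ B` is invisible to both
pullbacks. -/
theorem splits_var (hK : IsBooleanClosed K) {n X : ℕ} {x : Fin n → ℕ} (hKx : K (var n X x))
    {b : Bool} (hP : ∀ i, P (x i) = b) : Splits.{u, v, w} K P (var n X x) := by
  have hfree : ∀ y ∈ (var (L := L) n X x).freeVars,
      y ∈ (var (L := L) n X x).freeVars ∧ P y = b := by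
    intro y hy
    refine ⟨hy, ?_⟩
    obtain ⟨i, -, rfl⟩ := Finset.mem_image.1 hy
    exact hP i
  cases b with
  | true =>
    refine ⟨[(var n X x, SOFormula.top)], ?_, fun A B _ _ vA vB V => ?_⟩
    · simpa using ⟨⟨hKx, hfree, subset_rfl⟩, IsPart.top hK⟩
    · simp only [List.mem_singleton, exists_eq_left, sat_top, and_true, Sat, pullback]
      exact iff_of_eq (congrArg _ (funext fun i => glue_true (hP i)))
  | false =>
    refine ⟨[(SOFormula.top, var n X x)], ?_, fun A B _ _ vA vB V => ?_⟩
    · simpa using ⟨IsPart.top hK, ⟨hKx, hfree, subset_rfl⟩⟩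
    · simp only [List.mem_singleton, exists_eq_left, sat_top, true_and, Sat, pullback]
      exact iff_of_eq (congrArg _ (funext fun i => glue_false (hP i)))

/-- The witness lies in one of the summands, so `φ` is split with `x` moved to either side. Only the
component on that side can mention `x`, and it alone receives the quantifier. -/
theorem splits_ex (hex : ∀ (x : ℕ) (α : SOFormula L), K α → K (ex x α)) {x : ℕ}
    (h : ∀ P, Splits.{u, v, w} K P φ) : Splits.{u, v, w} K P (ex x φ) := by
  obtain ⟨l₁, hl₁, hs₁⟩ := h (Function.update P x true)
  obtain ⟨l₂, hl₂, hs₂⟩ := h (Function.update P x false)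
  have bound : ∀ {b c : Bool} {α : SOFormula L}, IsPart K (Function.update P x b) c φ α →
      ∀ y ∈ α.freeVars, y ≠ x → y ∈ (ex x φ).freeVars ∧ P y = c := by
    intro b c α hα y hy hyx
    have := hα.freeVars y hy
    rw [Function.update_of_ne hyx] at this
    exact ⟨by simp [freeVars, this.1, hyx], this.2⟩
  have same : ∀ {b : Bool} {α : SOFormula L}, IsPart K (Function.update P x b) b φ α →
      IsPart K P b (ex x φ) (ex x α) := by
    intro b α hα
    refine ⟨hex _ _ hα.mem, fun y hy => ?_, hα.freeRelVars⟩
    simp only [freeVars, Finset.mem_sdiff, Finset.mem_singleton] at hy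
    exact bound hα y hy.1 hy.2
  have other : ∀ {b : Bool} {α : SOFormula L}, IsPart K (Function.update P x b) (!b) φ α →
      IsPart K P (!b) (ex x φ) α := by
    intro b α hα
    refine ⟨hα.mem, fun y hy => bound hα y hy ?_, hα.freeRelVars⟩
    rintro rfl
    have := (hα.freeVars y hy).2
    simp at this
  refine ⟨l₁.map (fun p => (ex x p.1, p.2)) ++ l₂.map (fun p => (p.1, ex x p.2)), ?_, ?_⟩
  · intro q hq
    rcases List.mem_append.1 hq with hq | hq <;> obtain ⟨p, hp, rfl⟩ := List.mem_map.1 hq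
    · exact ⟨same (hl₁ p hp).1, other (hl₁ p hp).2⟩
    · exact ⟨other (hl₂ p hp).1, same (hl₂ p hp).2⟩
  · intro A B _ _ vA vB V
    simp only [Sat, Sum.exists, update_glue_inl, update_glue_inr, hs₁ A B _ vB V,
      hs₂ A B vA _ V, List.mem_append, or_and_right, exists_or, List.mem_map, ↓existsAndEq,
      and_true]
    refine or_congr ⟨?_, ?_⟩ ⟨?_, ?_⟩
    · rintro ⟨a, p, hp, h1, h2⟩; exact ⟨p, hp, ⟨a, h1⟩, h2⟩
    · rintro ⟨p, hp, ⟨a, h1⟩, h2⟩; exact ⟨a, p, hp, h1, h2⟩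
    · rintro ⟨b, p, hp, h1, h2⟩; exact ⟨p, hp, h1, ⟨b, h2⟩⟩
    · rintro ⟨p, hp, h1, ⟨b, h2⟩⟩; exact ⟨b, p, hp, h1, h2⟩

/-- A tuple of positive length cannot come from both summands, so the two pullbacks of a relation
can be prescribed independently and the quantifier distributes over the pair. -/
theorem splits_exRel_of_pos {n : ℕ} (hn : n ≠ 0) {X : ℕ}
    (hex : ∀ α : SOFormula L, K α → K (exRel n X α)) (h : Splits.{u, v, w} K P φ) :
    Splits.{u, v, w} K P (exRel n X φ) := by
  obtain ⟨l, hl, hs⟩ := h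
  refine ⟨l.map fun p => (exRel n X p.1, exRel n X p.2), fun q hq => ?_, fun A B _ _ vA vB V => ?_⟩
  · obtain ⟨p, hp, rfl⟩ := List.mem_map.1 hq
    exact ⟨(hl p hp).1.exRel (hex _ (hl p hp).1.mem), (hl p hp).2.exRel (hex _ (hl p hp).2.mem)⟩
  · simp only [Sat, hs A B vA vB _, pullback_update, List.mem_map, ↓existsAndEq, and_true]
    constructor
    · rintro ⟨R, p, hp, h1, h2⟩
      exact ⟨p, hp, ⟨_, h1⟩, ⟨_, h2⟩⟩
    · rintro ⟨p, hp, ⟨RA, h1⟩, ⟨RB, h2⟩⟩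
      have i₀ : Fin n := ⟨0, Nat.pos_of_ne_zero hn⟩
      refine ⟨fun x => (∃ a, x = Sum.inl ∘ a ∧ RA a) ∨ ∃ b, x = Sum.inr ∘ b ∧ RB b, p, hp, ?_, ?_⟩
      · convert h1 using 4 with a
        constructor
        · rintro (⟨a', ha, h⟩ | ⟨b, hb, -⟩)
          · rwa [Sum.inl_injective.comp_left ha]
          · cases congrFun hb i₀
        · exact fun h => Or.inl ⟨a, rfl, h⟩
      · convert h2 using 4 with b
        constructor
        · rintro (⟨a, ha, -⟩ | ⟨b', hb, h⟩)
          · cases congrFun ha i₀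
          · rwa [Sum.inr_injective.comp_left hb]
        · exact fun h => Or.inr ⟨b, rfl, h⟩

/-- Both pullbacks of a nullary relation carry the same truth value, so independent quantifiers
would be too weak. The list is doubled, and `nullaryLit` forces both components to use the same
value `b`. -/
theorem splits_exRel_zero (hK : IsBooleanClosed K) {X : ℕ} (hvar : ∀ x, K (var 0 X x))
    (hex : ∀ α : SOFormula L, K α → K (exRel 0 X α)) (h : Splits.{u, v, w} K P φ) :
    Splits.{u, v, w} K P (exRel 0 X φ) := by
  obtain ⟨l, hl, hs⟩ := h
  have part : ∀ {b c : Bool} {α : SOFormula L}, IsPart K P c φ α →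
      IsPart K P c (exRel 0 X φ) (exRel 0 X (SOFormula.and (nullaryLit X b) α)) := by
    intro b c α hα
    have hlit : (nullaryLit (L := L) X b).freeVars = ∅ ∧
        (nullaryLit (L := L) X b).freeRelVars = {(0, X)} ∧ K (nullaryLit X b) := by
      cases b
      · exact ⟨by simp [nullaryLit, freeVars], rfl, hK.neg (hvar _)⟩
      · exact ⟨by simp [nullaryLit, freeVars], rfl, hvar _⟩
    refine ⟨hex _ (hK.and hlit.2.2 hα.mem), ?_, ?_⟩
    · simpa [freeVars, hlit.1] using hα.freeVars
    · intro Y hY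
      simp only [freeRelVars, hlit.2.1, Finset.mem_sdiff, Finset.mem_union,
        Finset.mem_singleton] at hY ⊢
      exact ⟨hα.freeRelVars (hY.1.resolve_left hY.2), hY.2⟩
  let f (b : Bool) (p : SOFormula L × SOFormula L) : SOFormula L × SOFormula L :=
    (exRel 0 X (SOFormula.and (nullaryLit X b) p.1), exRel 0 X (SOFormula.and (nullaryLit X b) p.2))
  have hf : ∀ q, q ∈ l.map (f true) ++ l.map (f false) ↔ ∃ b, ∃ p ∈ l, q = f b p := by
    intro q
    simp [Bool.exists_bool, or_comm, eq_comm]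
  refine ⟨l.map (f true) ++ l.map (f false), fun q hq => ?_, fun A B _ _ vA vB V => ?_⟩
  · obtain ⟨b, p, hp, rfl⟩ := (hf q).1 hq
    exact ⟨part (hl p hp).1, part (hl p hp).2⟩
  · simp only [hf, Sat, hs A B vA vB _, pullback_update]
    constructor
    · classical
      rintro ⟨R, p, hp, h1, h2⟩
      refine ⟨_, ⟨decide (R Fin.elim0), p, hp, rfl⟩, ⟨_, ?_, h1⟩, ⟨_, ?_, h2⟩⟩ <;>
      · rw [sat_nullaryLit]
        funext a
        simp only [Function.update_self, decide_eq_true_eq]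
        exact congrArg R (Subsingleton.elim _ _)
    · rintro ⟨_, ⟨b, p, hp, rfl⟩, ⟨RA, h1, h1'⟩, ⟨RB, h2, h2'⟩⟩
      simp only [sat_nullaryLit, Function.update_self] at h1 h2
      subst h1 h2
      exact ⟨fun _ => b = true, p, hp, h1', h2'⟩

/-- A true guard has all its variables in one summand, and these include those of `ψ`; hence
constant sides suffice for `ψ`. If the guard keeps a free variable, that summand is the one given by
`s`; otherwise either is possible. -/
theorem splits_guarded_exs {ys : List ℕ} {α : SOFormula L} (s : Bool) (hα : α.IsAtom)
    (hψα : ψ.freeVars ⊆ α.freeVars)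
    (h : ∀ b : Bool, Splits.{u, v, w} IsGuarded (fun _ => b) ψ) :
    Splits.{u, v, w} IsGuarded (fun _ => s) (exs ys (SOFormula.and α ψ)) := by
  classical
  obtain ⟨l₁, hl₁, hs₁⟩ := h true
  obtain ⟨l₂, hl₂, hs₂⟩ := h false
  -- No variable lies on the side opposite to a constant one, so `β` has no free first-order
  -- variables and fits any side `c`.
  have other : ∀ {b : Bool} {β : SOFormula L}, IsPart IsGuarded (fun _ => b) (!b) ψ β →
      ∀ c, IsPart IsGuarded (fun _ => s) c (exs ys (SOFormula.and α ψ)) β := by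
    intro b β hβ c
    refine ⟨hβ.mem, fun y hy => ?_, hβ.freeRelVars.trans ?_⟩
    · have := (hβ.freeVars y hy).2
      simp at this
    · rw [freeRelVars_exs]; exact Finset.subset_union_right
  have same : ∀ {b : Bool} {β : SOFormula L}, IsPart IsGuarded (fun _ => b) b ψ β →
      (s = b ∨ ∀ x ∈ α.freeVars, x ∈ ys) →
      IsPart IsGuarded (fun _ => s) b (exs ys (SOFormula.and α ψ))
        (exs ys (SOFormula.and α β)) := by
    intro b β hβ hsb
    have hβα : β.freeVars ⊆ α.freeVars := fun x hx => hψα (hβ.freeVars x hx).1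
    refine ⟨.exs ys hα hβ.mem hβα, fun y hy => ?_, ?_⟩
    · simp only [freeVars_exs, freeVars, Finset.union_eq_left.2 hβα, Finset.union_eq_left.2 hψα,
        Finset.mem_sdiff, List.mem_toFinset] at hy ⊢
      exact ⟨hy, hsb.resolve_right fun h => hy.2 (h y hy.1)⟩
    · simp only [freeRelVars_exs, freeRelVars]
      exact Finset.union_subset_union subset_rfl hβ.freeRelVars
  refine ⟨(if s = true ∨ ∀ x ∈ α.freeVars, x ∈ ys then
      l₁.map (fun p => (exs ys (SOFormula.and α p.1), p.2)) else []) ++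
    (if s = false ∨ ∀ x ∈ α.freeVars, x ∈ ys then
      l₂.map (fun p => (p.1, exs ys (SOFormula.and α p.2))) else []), ?_, ?_⟩
  · intro q hq
    rcases List.mem_append.1 hq with hq | hq <;> split_ifs at hq with hc
    · obtain ⟨p, hp, rfl⟩ := List.mem_map.1 hq
      exact ⟨same (hl₁ p hp).1 hc, other (hl₁ p hp).2 _⟩
    · simp at hq
    · obtain ⟨p, hp, rfl⟩ := List.mem_map.1 hq
      exact ⟨other (hl₂ p hp).1 _, same (hl₂ p hp).2 hc⟩
    · simp at hq
  · intro A B _ _ vA vB V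
    have : Nonempty A := ⟨vA 0⟩
    have : Nonempty B := ⟨vB 0⟩
    have hexs : ∀ {C : Type w} [L.Structure C] {β : SOFormula L} (v : ℕ → C)
        (V : (n : ℕ) → ℕ → (Fin n → C) → Prop), β.freeVars ⊆ α.freeVars →
        ((exs ys (SOFormula.and α β)).Sat v V ↔ ∃ v' : ℕ → C,
          (∀ x ∈ α.freeVars, x ∉ ys → v' x = v x) ∧ α.Sat v' V ∧ β.Sat v' V) := by
      intro C _ β v V hβ
      rw [sat_exs]
      simp only [freeVars, Finset.union_eq_left.2 hβ, Sat]
    have hL : ∀ p ∈ l₁, p.1.freeVars ⊆ α.freeVars :=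
      fun p hp x hx => hψα ((hl₁ p hp).1.freeVars x hx).1
    have hR : ∀ p ∈ l₂, p.2.freeVars ⊆ α.freeVars :=
      fun p hp x hx => hψα ((hl₂ p hp).2.freeVars x hx).1
    rw [hexs _ _ hψα]
    simp only [List.mem_append, or_and_right, exists_or]
    constructor
    · rintro ⟨v', hv', hα', hψ'⟩
      obtain ⟨P', va, vb, rfl⟩ := exists_eq_glue v'
      rcases (hα.sat_glue _ _ _ _).1 hα' with ⟨hP', hsα⟩ | ⟨hP', hsα⟩
      · left
        have hc : s = true ∨ ∀ x ∈ α.freeVars, x ∈ ys := by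
          by_contra! hc
          obtain ⟨x, hx, hxy⟩ := hc.2
          have := hv' x hx hxy
          simp [glue, hP' x hx, hc.1] at this
        rw [if_pos hc]
        -- The variables of `ψ` are guarded and lie in `A`, so the values in `B` may be reset to the
        -- original `vB`.
        rw [sat_congr ψ (v' := glue (fun _ => true) va vB) (V' := V) (fun x hx => by
          rw [glue_true (hP' x (hψα hx)), glue_true rfl]) (fun _ _ _ => rfl),
          hs₁ A B va vB V] at hψ'
        obtain ⟨p, hp, h1, h2⟩ := hψ'
        refine ⟨_, List.mem_map_of_mem hp, (hexs _ _ (hL p hp)).2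
          ⟨va, fun x hx hxy => ?_, hsα, h1⟩, h2⟩
        have hst := hc.resolve_right fun h => hxy (h x hx)
        simpa [glue, hP' x hx, hst] using hv' x hx hxy
      · right
        have hc : s = false ∨ ∀ x ∈ α.freeVars, x ∈ ys := by
          by_contra! hc
          obtain ⟨x, hx, hxy⟩ := hc.2
          have := hv' x hx hxy
          simp [glue, hP' x hx, hc.1] at this
        rw [if_pos hc]
        rw [sat_congr ψ (v' := glue (fun _ => false) vA vb) (V' := V) (fun x hx => by
          rw [glue_false (hP' x (hψα hx)), glue_false rfl]) (fun _ _ _ => rfl),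
          hs₂ A B vA vb V] at hψ'
        obtain ⟨p, hp, h1, h2⟩ := hψ'
        refine ⟨_, List.mem_map_of_mem hp, h1, (hexs _ _ (hR p hp)).2
          ⟨vb, fun x hx hxy => ?_, hsα, h2⟩⟩
        have hst := hc.resolve_right fun h => hxy (h x hx)
        simpa [glue, hP' x hx, hst] using hv' x hx hxy
    · rintro (⟨q, hq, h1, h2⟩ | ⟨q, hq, h1, h2⟩) <;> split_ifs at hq with hc
      · obtain ⟨p, hp, rfl⟩ := List.mem_map.1 hq
        obtain ⟨va, hva, hsα, hp1⟩ := (hexs _ _ (hL p hp)).1 h1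
        refine ⟨glue (fun _ => true) va vB, fun x hx hxy => ?_,
          (hα.sat_glue _ _ _ _).2 (Or.inl ⟨fun _ _ => rfl, hsα⟩),
          (hs₁ A B va vB V).2 ⟨p, hp, hp1, h2⟩⟩
        have hst := hc.resolve_right fun h => hxy (h x hx)
        simp [glue, hst, hva x hx hxy]
      · simp at hq
      · obtain ⟨p, hp, rfl⟩ := List.mem_map.1 hq
        obtain ⟨vb, hvb, hsα, hp2⟩ := (hexs _ _ (hR p hp)).1 h2
        refine ⟨glue (fun _ => false) vA vb, fun x hx hxy => ?_,
          (hα.sat_glue _ _ _ _).2 (Or.inr ⟨fun _ _ => rfl, hsα⟩),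
          (hs₂ A B vA vb V).2 ⟨p, hp, h1, hp2⟩⟩
        have hst := hc.resolve_right fun h => hxy (h x hx)
        simp [glue, hst, hvb x hx hxy]
      · simp at hq

/-- Constant sides form a strong enough induction hypothesis because guarded quantifiers lead back
to constant sides; so a relation variable of higher arity is never evaluated at a mixed tuple. -/
theorem IsGuarded.splits (hφ : φ.IsGuarded) :
    ∀ s : Bool, Splits.{u, v, w} IsGuarded (fun _ => s) φ := by
  have hK := isBooleanClosed_isGuarded (L := L)
  have hexRel : ∀ {n X : ℕ} {φ : SOFormula L} {s : Bool},
      Splits.{u, v, w} IsGuarded (fun _ => s) φ →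
      Splits.{u, v, w} IsGuarded (fun _ => s) (SOFormula.exRel n X φ) := by
    intro n X φ s h
    by_cases hn : n = 0
    · subst hn
      exact splits_exRel_zero hK (.var 0 X) (fun _ => .exRel 0 X) h
    · exact splits_exRel_of_pos hn (fun _ => .exRel n X) h
  induction hφ with
  | eq x y => exact fun s => splits_atom hK (.eq x y) (.eq x y)
  | rel R x => exact fun s => splits_atom hK (.rel R x) (.rel R x)
  | var n X x => exact fun s => splits_var hK (.var n X x) fun _ => rfl
  | neg _ ih => exact fun s => (ih s).neg hK
  | and _ _ ih₁ ih₂ => exact fun s => (ih₁ s).and hK (ih₂ s)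
  | or _ _ ih₁ ih₂ => exact fun s => (ih₁ s).or (ih₂ s)
  | exs ys hα _ hsub ih => exact fun s => splits_guarded_exs s hα hsub ih
  | @alls ys α ψ hα _ hsub ih =>
    intro s
    refine ((splits_guarded_exs (ys := ys) (ψ := SOFormula.neg ψ) s hα hsub
      fun b => (ih b).neg hK).neg hK).congr ?_ ?_ ?_
    · simp [freeVars, freeVars_exs, freeVars_alls, imp]
    · simp [freeRelVars, freeRelVars_exs, freeRelVars_alls, imp]
    · intro A _ v V
      rw [sat_alls]
      simp [Sat, sat_exs, imp, freeVars]
  | exRel n X _ ih => exact fun s => hexRel (ih s)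
  | allRel n X _ ih =>
    exact fun s => ((hexRel (n := n) (X := X) ((ih s).neg hK)).neg hK).congr rfl rfl
      fun _ _ _ _ => by simp [Sat]

/-- Unrestricted quantifiers call for every `P`; this does no harm, since a unary atom has its only
argument on one side. -/
theorem IsMonadic.splits (hφ : φ.IsMonadic) : ∀ P, Splits.{u, v, w} IsMonadic P φ := by
  have hK := isBooleanClosed_isMonadic (L := L)
  induction φ with
  | eq x y => exact fun P => splits_atom hK (.eq x y) trivial
  | rel R x => exact fun P => splits_atom hK (.rel R x) trivial
  | var n X x =>
    obtain rfl : n = 1 := hφ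
    exact fun P => splits_var hK rfl (b := P (x 0)) fun i => by rw [Subsingleton.elim i 0]
  | neg φ ih => exact fun P => (ih hφ P).neg hK
  | and φ ψ ih₁ ih₂ => exact fun P => (ih₁ hφ.1 P).and hK (ih₂ hφ.2 P)
  | or φ ψ ih₁ ih₂ => exact fun P => (ih₁ hφ.1 P).or (ih₂ hφ.2 P)
  | ex x φ ih => exact fun P => splits_ex (fun _ _ h => h) (ih hφ)
  | all x φ ih =>
    exact fun P => ((splits_ex (P := P) (x := x) (fun _ _ h => h)
      fun P => (ih hφ P).neg hK).neg hK).congr rfl rfl fun _ _ _ _ => by simp [Sat]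
  | exRel n X φ ih =>
    obtain ⟨rfl, hφ⟩ := hφ
    exact fun P => splits_exRel_of_pos one_ne_zero (fun _ h => ⟨rfl, h⟩) (ih hφ P)
  | allRel n X φ ih =>
    obtain ⟨rfl, hφ⟩ := hφ
    exact fun P => ((splits_exRel_of_pos (X := X) one_ne_zero (fun _ h => ⟨rfl, h⟩)
      ((ih hφ P).neg hK)).neg hK).congr rfl rfl fun _ _ _ _ => by simp [Sat]

end Splits

end SOFormula

/-! ### The homomorphism order and a criterion for being a CSP -/

namespace FinStr

variable {L : FirstOrder.Language.{u, v}}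

/-- The homomorphism order on finite structures. -/
def HomLE (A B : FinStr.{u, v, w} L) : Prop := Nonempty (A →[L] B)

theorem HomLE.refl (A : FinStr.{u, v, w} L) : HomLE A A := ⟨FirstOrder.Language.Hom.id L A⟩

theorem HomLE.trans {A B C : FinStr.{u, v, w} L} : HomLE A B → HomLE B C → HomLE A C :=
  fun ⟨f⟩ ⟨g⟩ => ⟨g.comp f⟩

theorem finite_relations [Finite L.Symbols] : Finite (Σ n, L.Relations n) :=
  Finite.of_injective (β := L.Symbols) Sum.inr Sum.inr_injective

variable [L.IsRelational]

/-- The disjoint union of two finite structures. -/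
def sum (A B : FinStr.{u, v, w} L) : FinStr.{u, v, w} L := ⟨A ⊕ B⟩

theorem homLE_sum_left (A B : FinStr.{u, v, w} L) : HomLE A (A.sum B) :=
  ⟨{ toFun := Sum.inl
     map_fun' := fun f => isEmptyElim f
     map_rel' := fun _ x hx => Or.inl ⟨x, rfl, hx⟩ }⟩

theorem homLE_sum_right (A B : FinStr.{u, v, w} L) : HomLE B (A.sum B) :=
  ⟨{ toFun := Sum.inr
     map_fun' := fun f => isEmptyElim f
     map_rel' := fun _ x hx => Or.inr ⟨x, rfl, hx⟩ }⟩

theorem sum_homLE {A B C : FinStr.{u, v, w} L} : HomLE A C → HomLE B C → HomLE (A.sum B) C := by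
  rintro ⟨f⟩ ⟨g⟩
  refine ⟨{ toFun := Sum.elim f g, map_fun' := fun f => isEmptyElim f, map_rel' := ?_ }⟩
  rintro n R x (⟨a, rfl, ha⟩ | ⟨b, rfl, hb⟩)
  · exact f.map_rel R a ha
  · exact g.map_rel R b hb

theorem countable_structures [Finite L.Symbols] (X : Type w) [Finite X] :
    Countable (L.Structure X) := by
  have := finite_relations (L := L)
  let f : L.Structure X → Set (Σ R : Σ n, L.Relations n, Fin R.1 → X) :=
    fun S => {R | S.RelMap R.1.2 R.2}
  refine Function.Injective.countable (f := f) fun S T h => ?_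
  refine FirstOrder.Language.Structure.ext ?_ ?_
  · funext n g; exact isEmptyElim g
  · funext n R x
    exact propext (Set.ext_iff.1 h ⟨⟨n, R⟩, x⟩)

/-- A nonempty class of finite structures has a countable cofinal subset. -/
theorem exists_cofinal_seq [Finite L.Symbols] {U : Set (FinStr.{u, v, w} L)} (hU : U.Nonempty)
    (hlow : ∀ A B, HomLE A B → B ∈ U → A ∈ U) :
    ∃ F : ℕ → FinStr.{u, v, w} L, (∀ k, F k ∈ U) ∧ ∀ A ∈ U, ∃ k, HomLE A (F k) := by
  have := fun n => countable_structures (L := L) (ULift.{w} (Fin (n + 1)))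
  -- Every finite structure is isomorphic to one on some `Fin (n + 1)`, and there are only countably
  -- many of those; the shift reflects nonempty domains.
  let mk : (Σ n : ℕ, L.Structure (ULift.{w} (Fin (n + 1)))) → FinStr.{u, v, w} L :=
    fun t => @FinStr.mk L (ULift.{w} (Fin (t.1 + 1))) t.2 _ _
  have hmk : ∀ A : FinStr.{u, v, w} L, ∃ t, HomLE A (mk t) ∧ HomLE (mk t) A := by
    intro A
    obtain ⟨n, ⟨e⟩⟩ := Finite.exists_equiv_fin A
    obtain ⟨n, rfl⟩ : ∃ m, n = m + 1 :=
      Nat.exists_eq_succ_of_ne_zero fun h => by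
        subst h; exact (e (Classical.arbitrary A)).elim0
    let e' : A ≃ ULift.{w} (Fin (n + 1)) := e.trans Equiv.ulift.symm
    let S : L.Structure (ULift.{w} (Fin (n + 1))) :=
      { funMap := fun f => isEmptyElim f
        RelMap := fun R x => FirstOrder.Language.Structure.RelMap R (e'.symm ∘ x) }
    refine ⟨⟨n, S⟩, ⟨@FirstOrder.Language.Hom.mk L A _ _ S e' (fun f => isEmptyElim f)
      fun R x hx => ?_⟩, ⟨@FirstOrder.Language.Hom.mk L _ A S _ e'.symm (fun f => isEmptyElim f)
      fun R x hx => hx⟩⟩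
    change FirstOrder.Language.Structure.RelMap R (e'.symm ∘ e' ∘ x)
    rwa [← Function.comp_assoc, e'.symm_comp_self, Function.id_comp]
  have : Nonempty {t // mk t ∈ U} := by
    obtain ⟨A, hA⟩ := hU
    obtain ⟨t, -, ht⟩ := hmk A
    exact ⟨⟨t, hlow _ _ ht hA⟩⟩
  obtain ⟨e, he⟩ := exists_surjective_nat {t // mk t ∈ U}
  refine ⟨fun k => mk (e k).1, fun k => (e k).2, fun A hA => ?_⟩
  obtain ⟨t, hAt, htA⟩ := hmk A
  obtain ⟨k, hk⟩ := he ⟨t, hlow _ _ htA hA⟩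
  exact ⟨k, by simpa only [hk] using hAt⟩

/-- The disjoint union of a sequence of structures. -/
@[reducible] def sigmaStructure (D : ℕ → FinStr.{u, v, w} L) : L.Structure (Σ k, D k) where
  funMap f := isEmptyElim f
  RelMap R x := ∃ k, ∃ a : Fin _ → D k, x = (fun i => ⟨k, a i⟩) ∧
    FirstOrder.Language.Structure.RelMap R a

/-- A nonempty class that is closed under disjoint unions and inverse homomorphisms is a CSP. -/
theorem isCSP_of_closed [Finite L.Symbols] {U : Set (FinStr.{u, v, w} L)} (hU : U.Nonempty)
    (hlow : ∀ A B, HomLE A B → B ∈ U → A ∈ U) (hsum : ∀ A ∈ U, ∀ B ∈ U, A.sum B ∈ U) :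
    IsCSP U := by
  obtain ⟨F, hF, hcof⟩ := exists_cofinal_seq hU hlow
  -- The partial sums form an increasing cofinal chain, whose disjoint union is the template. A
  -- finite structure uses finitely many components, and these all map to a single later one, which
  -- lies in `U`.
  obtain ⟨D, hD, hFD, hmono⟩ : ∃ D : ℕ → FinStr.{u, v, w} L, (∀ k, D k ∈ U) ∧
      (∀ k, HomLE (F k) (D k)) ∧ ∀ {k m}, k ≤ m → HomLE (D k) (D m) := by
    refine ⟨fun k => k.rec (F 0) fun k E => E.sum (F (k + 1)), fun k => ?_, fun k => ?_,
      fun {k m} h => ?_⟩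
    · induction k with
      | zero => exact hF 0
      | succ k ih => exact hsum _ ih _ (hF _)
    · cases k with
      | zero => exact HomLE.refl _
      | succ k => exact homLE_sum_right _ _
    · induction h with
      | refl => exact HomLE.refl _
      | step _ ih => exact ih.trans (homLE_sum_left _ _)
  let := sigmaStructure D
  refine ⟨Σ k, D k, sigmaStructure D, ⟨⟨0, Classical.arbitrary (D 0)⟩⟩, Set.ext fun A => ⟨?_, ?_⟩⟩
  · intro hA
    obtain ⟨k, hk⟩ := hcof A hA
    obtain ⟨f⟩ := hk.trans (hFD k)
    exact ⟨{ toFun := fun a => ⟨k, f a⟩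
             map_fun' := fun f => isEmptyElim f
             map_rel' := fun R x hx => ⟨k, f ∘ x, rfl, f.map_rel R x hx⟩ }⟩
  · rintro ⟨f⟩
    have := finite_relations (L := L)
    -- The component is recorded for each related tuple, as the empty tuple of a nullary relation
    -- does not reveal it.
    have hwit : ∀ (n : ℕ) (R : L.Relations n) (x : Fin n → A), ∃ k : ℕ,
        FirstOrder.Language.Structure.RelMap R x → ∃ a : Fin n → D k,
          f ∘ x = (fun i => ⟨k, a i⟩) ∧ FirstOrder.Language.Structure.RelMap R a := by
      intro n R x
      by_cases hx : FirstOrder.Language.Structure.RelMap R x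
      · obtain ⟨k, h⟩ := f.map_rel R x hx
        exact ⟨k, fun _ => h⟩
      · exact ⟨0, fun h => (hx h).elim⟩
    choose c hc using hwit
    obtain ⟨N₁, hN₁⟩ := (Set.finite_range
      fun t : Σ R : Σ n, L.Relations n, Fin R.1 → A => c t.1.1 t.1.2 t.2).bddAbove
    obtain ⟨N₂, hN₂⟩ := (Set.finite_range fun a => (f a).1).bddAbove
    let N := max N₁ N₂
    -- One homomorphism is fixed per component, so all coordinates of a related tuple are moved by
    -- the same map.
    let g (k : ℕ) (h : k ≤ N) : D k →[L] D N := Classical.choice (hmono h)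
    have hcN : ∀ {n} (R : L.Relations n) x, c n R x ≤ N := fun {n} R x =>
      (hN₁ ⟨⟨⟨n, R⟩, x⟩, rfl⟩).trans (le_max_left _ _)
    have hfN : ∀ a, (f a).1 ≤ N := fun a => (hN₂ ⟨a, rfl⟩).trans (le_max_right _ _)
    refine hlow A (D N) ⟨{ toFun := fun a => g _ (hfN a) (f a).2
                           map_fun' := fun f => isEmptyElim f
                           map_rel' := fun {n} R x hx => ?_ }⟩ (hD N)
    obtain ⟨a, hxa, ha⟩ := hc n R x hx
    have key : ∀ (b : A) (k : ℕ) (hk : k ≤ N) (d : D k), f b = ⟨k, d⟩ →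
        g _ (hfN b) (f b).2 = g k hk d := by
      intro b k hk d h
      have : ∀ (y : Σ k, D k) (hy : y.1 ≤ N), y = ⟨k, d⟩ → g _ hy y.2 = g k hk d := by
        rintro _ _ rfl; rfl
      exact this _ (hfN b) h
    have : (fun a => g _ (hfN a) (f a).2) ∘ x = g _ (hcN R x) ∘ a :=
      funext fun i => key _ _ (hcN R x) _ (congrFun hxa i)
    rw [this]
    exact (g _ (hcN R x)).map_rel R a ha

end FinStr

/-! ### Covering by finitely many CSPs -/

open FinStr in
/-- A class of finite structures that is closed under inverse homomorphisms, and in which membership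
of `A ⊕ B` depends on `A` and on finitely much information `τ B` about `B`, is a finite union of
CSPs, each of the form `{A | A ⊕ D ∈ C}`. -/
theorem exists_ideal_cover {L : FirstOrder.Language.{u, v}} [L.IsRelational] [Finite L.Symbols]
    {C : Set (FinStr.{u, v, w} L)} (hlow : ∀ A B, HomLE A B → B ∈ C → A ∈ C) {T : Type*} [Finite T]
    (τ : FinStr.{u, v, w} L → T)
    (hτ : ∀ A B B' : FinStr.{u, v, w} L, τ B = τ B' → (A.sum B ∈ C ↔ A.sum B' ∈ C)) :
    ∃ M : Set (FinStr.{u, v, w} L), (∀ D ∈ M, IsCSP {A | A.sum D ∈ C}) ∧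
      ∀ A, A ∈ C ↔ ∃ D ∈ M, A.sum D ∈ C := by
  let U (D : FinStr.{u, v, w} L) : Set (FinStr.{u, v, w} L) := {A | A.sum D ∈ C}
  have hUmono : ∀ {D E}, HomLE D E → U E ⊆ U D := fun {D E} h A hA =>
    hlow _ _ (sum_homLE (homLE_sum_left _ _) (h.trans (homLE_sum_right A E))) hA
  -- By `hτ`, `U` factors through the finite type `T`.
  have hfin : (Set.range U).Finite := by
    have : ∀ D, U D = Function.extend τ U (fun _ => ∅) (τ D) := fun D =>
      (Function.FactorsThrough.extend_apply (f := τ) (g := U)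
        (fun B B' h => Set.ext fun A => hτ A B B' h) _ D).symm
    exact (Set.finite_range (Function.extend τ U fun _ => ∅)).subset
      (Set.range_subset_iff.2 fun D => ⟨τ D, (this D).symm⟩)
  -- These are the stable `D`: as `U` is antitone, the inclusion required here amounts to equality.
  refine ⟨{D | D ∈ C ∧ ∀ E ∈ C, HomLE D E → U D ⊆ U E}, ?_, fun A => ⟨fun hA => ?_, ?_⟩⟩
  · rintro D ⟨hD, hmax⟩
    refine isCSP_of_closed (U := U D) ⟨D, hlow _ _ (sum_homLE (HomLE.refl D) (HomLE.refl D)) hD⟩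
      (fun _ _ h hB => hlow _ _ (sum_homLE (h.trans (homLE_sum_left _ _)) (homLE_sum_right _ _)) hB)
      fun A hA B hB => ?_
    -- Stability is applied to `A ⊕ D`, which lies in `C` and above `D`.
    have hB' : B.sum (A.sum D) ∈ C := hmax _ hA (homLE_sum_right A D) hB
    exact hlow _ _ (sum_homLE (sum_homLE ((homLE_sum_left A D).trans (homLE_sum_right _ _))
      (homLE_sum_left _ _)) ((homLE_sum_right A D).trans (homLE_sum_right _ _))) hB'
  · obtain ⟨s, ⟨E, ⟨hE, hAE⟩, rfl⟩, hmin⟩ :=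
      (hfin.subset (Set.image_subset_range U {E | E ∈ C ∧ HomLE A E})).exists_minimal
        ⟨_, A, ⟨hA, HomLE.refl A⟩, rfl⟩
    refine ⟨E, ⟨hE, fun E' hE' h => ?_⟩, hlow _ _ (sum_homLE hAE (HomLE.refl E)) hE⟩
    exact hmin ⟨E', ⟨hE', hAE.trans h⟩, rfl⟩ (hUmono h)
  · rintro ⟨D, -, hAD⟩
    exact hlow _ _ (homLE_sum_left A D) hAD

/-! ### Defining the CSPs by sentences -/

open SOFormula FinStr in
/-- A sentence that splits over disjoint unions and whose finite models are closed under inverse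
homomorphisms decomposes into CSPs. -/
theorem decomposesIntoCSPs_of_splits {L : FirstOrder.Language.{u, v}} [L.IsRelational]
    [Finite L.Symbols] {K : SOFormula L → Prop} (hK : IsBooleanClosed K) {Φ : SOFormula L}
    (hΦ : ClosedUnderHom (finModels.{u, v, w} Φ)ᶜ) (hs : Φ.IsSentence) (hKΦ : K Φ) {P : ℕ → Bool}
    (hsplit : Splits.{u, v, w} K P Φ) :
    DecomposesIntoCSPs.{u, v, w} (fun φ => φ.IsSentence ∧ K φ) Φ := by
  classical
  obtain ⟨l, hl, hl'⟩ := hsplit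
  have hsent : ∀ {b : Bool} {α : SOFormula L}, IsPart K P b Φ α → α.IsSentence ∧ K α := by
    intro b α h
    refine ⟨⟨Finset.eq_empty_of_forall_notMem fun x hx => ?_, ?_⟩, h.mem⟩
    · simpa [hs.1] using (h.freeVars x hx).1
    · simpa [hs.2] using h.freeRelVars
  have hKs : IsBooleanClosed fun φ : SOFormula L => φ.IsSentence ∧ K φ :=
    ⟨⟨isSentence_top, hK.top⟩, fun h => ⟨h.1.neg, hK.neg h.2⟩,
      fun h h' => ⟨h.1.and h'.1, hK.and h.2 h'.2⟩, fun h h' => ⟨h.1.or h'.1, hK.or h.2 h'.2⟩⟩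
  have hlow : ∀ A B : FinStr.{u, v, w} L, HomLE A B → B ∈ finModels Φ → A ∈ finModels Φ :=
    fun A B h hB => by_contra fun hA => hΦ A B hA h hB
  -- `τ B` records which second components hold in `B`; `sel` collects the matching first
  -- components.
  let τ : FinStr.{u, v, w} L → l.toFinset → Prop := fun B p => Models B p.1.2
  let sel (t : l.toFinset → Prop) : List (SOFormula L) :=
    (l.attach.filter fun p => t ⟨p.1, List.mem_toFinset.2 p.2⟩).map fun p => p.1.1
  have hsel : ∀ t, ∀ α ∈ sel t, α.IsSentence ∧ K α := by
    intro t α hα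
    obtain ⟨p, -, rfl⟩ := List.mem_map.1 hα
    exact hsent (hl p.1 p.2).1
  have hsum : ∀ A D : FinStr.{u, v, w} L,
      A.sum D ∈ finModels Φ ↔ Models A (disj (sel (τ D))) := by
    intro A D
    obtain ⟨a₀⟩ := A.nonempty
    obtain ⟨d₀⟩ := D.nonempty
    let V : (n : ℕ) → ℕ → (Fin n → A ⊕ D) → Prop := fun _ _ _ => False
    have h1 : A.sum D ∈ finModels Φ ↔ Φ.Sat (glue P (fun _ => a₀) fun _ => d₀) V :=
      hs.models_iff (A := A ⊕ D) _ V
    rw [h1, hl' A D _ _ V, (hKs.disj (hsel _)).1.models_iff (fun _ => a₀) (pullback Sum.inl V),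
      sat_disj]
    constructor
    · rintro ⟨p, hp, hA, hD⟩
      refine ⟨p.1, List.mem_map.2 ⟨⟨p, hp⟩, List.mem_filter.2 ⟨List.mem_attach _ _, ?_⟩, rfl⟩, hA⟩
      simpa using ((hsent (hl p hp).2).1.models_iff _ _).2 hD
    · rintro ⟨α, hα, hA⟩
      obtain ⟨p, hp, rfl⟩ := List.mem_map.1 hα
      have hD : Models D p.1.2 := by simpa using (List.mem_filter.1 hp).2
      exact ⟨p.1, p.2, hA, hD _ _⟩
  obtain ⟨M, hM, hcover⟩ := exists_ideal_cover hlow τ fun A B B' h => by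
    rw [hsum, hsum, h]
  -- `M` may be infinite, so the sentences are indexed by the finitely many types it realizes.
  obtain ⟨m, ⟨e⟩⟩ := Finite.exists_equiv_fin (τ '' M)
  let Ψ (i : Fin m) : SOFormula L := disj (sel (e.symm i).1)
  have hΨ : ∀ i, (Ψ i).IsSentence ∧ K (Ψ i) := fun i => hKs.disj (hsel _)
  have hΨmodels : ∀ i, ∃ D ∈ M, ∀ A : FinStr.{u, v, w} L, Models A (Ψ i) ↔ A.sum D ∈ finModels Φ := by
    intro i
    obtain ⟨D, hD, h⟩ := (e.symm i).2
    exact ⟨D, hD, fun A => by rw [hsum, h]⟩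
  have hcover' : ∀ A : FinStr.{u, v, w} L, A ∈ finModels Φ ↔ ∃ i, Models A (Ψ i) := by
    intro A
    rw [hcover A]
    constructor
    · rintro ⟨D, hD, h⟩
      refine ⟨e ⟨_, D, hD, rfl⟩, ?_⟩
      simpa [Ψ] using (hsum A D).1 h
    · rintro ⟨i, hi⟩
      obtain ⟨D, hD, h⟩ := hΨmodels i
      exact ⟨D, hD, (h A).1 hi⟩
  -- On finite structures `Φ` is equivalent to the disjunction of the `Ψ j`, so neither `rest` nor
  -- the conjunct `Φ` changes the finite models of `Ψ i`. On infinite ones, `Φ` discards spurious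
  -- models and `rest` catches models of `Φ` satisfying no `Ψ j`.
  let rest : SOFormula L := neg (disj (List.ofFn Ψ))
  have hrest : rest.IsSentence ∧ K rest :=
    hKs.neg (hKs.disj fun φ hφ => by obtain ⟨i, rfl⟩ := (List.mem_ofFn' _ _).1 hφ; exact hΨ i)
  let Θ (i : Fin m) : SOFormula L := and Φ (or (Ψ i) rest)
  have hΘ : ∀ i, (Θ i).IsSentence ∧ K (Θ i) := fun i =>
    hKs.and ⟨hs, hKΦ⟩ (hKs.or (hΨ i) hrest)
  have hΘmodels : ∀ (A : Type w) [L.Structure A] [Nonempty A] (i : Fin m), Models A (Θ i) ↔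
      Models A Φ ∧ (Models A (Ψ i) ∨ ¬ ∃ j, Models A (Ψ j)) := by
    intro A _ _ i
    let v : ℕ → A := fun _ => Classical.arbitrary A
    let V : (n : ℕ) → ℕ → (Fin n → A) → Prop := fun _ _ _ => False
    simp only [(hΘ i).1.models_iff v V, hs.models_iff v V, (hΨ _).1.models_iff v V, Θ, rest, Sat,
      sat_disj, List.mem_ofFn', Set.exists_range_iff]
  have hΘfin : ∀ i, finModels.{u, v, w} (Θ i) = finModels (Ψ i) := by
    intro i
    ext A
    refine (hΘmodels A i).trans ⟨fun h => ?_, fun h => ?_⟩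
    · exact h.2.resolve_right fun h' => h' ((hcover' A).1 h.1)
    · exact ⟨(hcover' A).2 ⟨i, h⟩, Or.inl h⟩
  refine ⟨m, Θ, fun i => ⟨hΘ i, ?_⟩, ?_, ?_⟩
  · obtain ⟨D, hD, h⟩ := hΨmodels i
    rw [hΘfin, show finModels (Ψ i) = {A | A.sum D ∈ finModels Φ} from Set.ext h]
    exact hM D hD
  · ext A
    simp only [Set.mem_iUnion, hΘfin]
    exact hcover' A
  · rintro ⟨A₀, hA₀⟩ A _ _
    -- A finite model of `Φ` guarantees at least one disjunct, to which the uncovered infinite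
    -- models are assigned.
    obtain ⟨i₀, -⟩ := (hcover' A₀).1 hA₀
    simp only [hΘmodels]
    refine ⟨fun h => ?_, fun ⟨_, h, _⟩ => h⟩
    by_cases hj : ∃ j, Models A (Ψ j)
    · obtain ⟨j, hj⟩ := hj
      exact ⟨j, h, Or.inl hj⟩
    · exact ⟨i₀, h, Or.inr hj⟩

theorem lemma4p9 {L : FirstOrder.Language.{u, v}} [L.IsRelational] [Finite L.Symbols] (Φ : SOFormula L)
    (hΦ : ClosedUnderHom (finModels.{u, v, w} Φ)ᶜ) :
    (IsGSOSentence Φ → DecomposesIntoCSPs.{u, v, w} IsGSOSentence Φ) ∧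
    (IsMSOSentence Φ → DecomposesIntoCSPs.{u, v, w} IsMSOSentence Φ) :=
  ⟨fun h => decomposesIntoCSPs_of_splits SOFormula.isBooleanClosed_isGuarded hΦ h.1 h.2
      (h.2.splits true),
    fun h => decomposesIntoCSPs_of_splits SOFormula.isBooleanClosed_isMonadic hΦ h.1 h.2
      (h.2.splits fun _ => true)⟩
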